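/- Let $n\in\mathbb N$ and let $\nu$ be a Lévy measure on $\mathbb R^n$ concentrated on $\mathbb Z^n\setminus\{0\}$ with $\int\min(1,\|y\|)\,\nu(dy)<\infty$. Let $N$ be a Poisson random measure on $\mathbb R^n\times[0,1]\times\mathbb R$ with intensity $\nu(dy)\,dx\,ds$, and for Borel $B\subset[0,1]\times\mathbb R$ put $L^{(i)}(B)=\int_{\mathbb R^n\times B}y_i\,N(dy,dx,ds)$, $i=1,\dots,n$. Let $L'=(L'^{(1)},\dots,L'^{(n)})$ be a Lévy seed, i.e. a random vector with $\mathbb E\,e^{i\theta^\top L'}=\exp\int(e^{i\theta^\top y}-1)\,\nu(dy)$ for all $\theta\in\mathbb R^n$. Let $A^{(1)},\dots,A^{(n)}$ be trawls, i.e. Borel subsets of $[0,1]\times(-\infty,0]$ of finite Lebesgue measure, and let $A^{(i)}_t=A^{(i)}+(0,t)$ and $Y^{(i)}_t=L^{(i)}(A^{(i)}_t)$. For $1\le i\le j\le n$ let $\nu^{(i,j)}$ be the image of $\nu$ under $y\mapsto(y_i,y_j)$, and set $$\kappa_{i,j}=\int_{\mathbb R}\int_{\mathbb R}y_iy_j\,\nu^{(i,j)}(dy_i,dy_j),\qquad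 R_{ij}(h)=\mathrm{Leb}\big(A^{(i)}\cap A^{(j)}_h\big)\quad(h\ge0).$$ (1) If $y_i$, $y_j$ and $y_iy_j$ are $\nu$-integrable, then for all $t,h\ge0$ the variables $Y^{(i)}_t$, $Y^{(j)}_{t+h}$ and their product are integrable and $$\mathrm{Cov}\big(Y^{(i)}_t,Y^{(j)}_{t+h}\big)=R_{ij}(h)\,\kappa_{i,j}.$$ (2) If $y_i^2$ and $y_j^2$ are $\nu$-integrable, then $L'^{(i)}$, $L'^{(j)}$ are square integrable, and for all $t,h\ge0$ the variables $Y^{(i)}_t$, $Y^{(j)}_{t+h}$ are square integrable with variances $\mathrm{Leb}(A^{(i)})\mathrm{Var}(L'^{(i)})$ and $\mathrm{Leb}(A^{(j)})\mathrm{Var}(L'^{(j)})$, and $$\mathrm{Cor}\big(Y^{(i)}_t,Y^{(j)}_{t+h}\big)=\frac{R_{ij}(h)\,\kappa_{i,j}}{\sqrt{\mathrm{Leb}(A^{(i)})\mathrm{Var}(L'^{(i)})\,\mathrm{Leb}(A^{(j)})\mathrm{Var}(L'^{(j)})}}=\frac{R_{ij}(h)}{\sqrt{\mathrm{Leb}(A^{(i)})\mathrm{Leb}(A^{(j)})}}\cdot\frac{\kappa_{i,j}}{\sqrt{\mathrm{Var}(L'^{(i)})\mathrm{Var}(L'^{(j)})}},$$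 so that the cross-correlation function is proportional to the autocorrelator $R_{ij}$. (If a denominator vanishes, the quotients are read as $0$.) -/

import Mathlib

open MeasureTheory ProbabilityTheory
open scoped ENNReal NNReal

noncomputable section

namespace TrawlProcess

/-- The Poisson distribution with mean `c ∈ [0, ∞]`, as a law on `[0, ∞]`; mean `∞` gives the
point mass at `∞`. -/
def poissonLaw (c : ℝ≥0∞) : Measure ℝ≥0∞ :=
  open Classical in
  if c = ∞ then Measure.dirac ∞
  else (poissonMeasure c.toNNReal).map (fun k : ℕ => (k : ℝ≥0∞))

/-- `N` is a Poisson random measure on `E` with intensity measure `μ`, on the probability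
space `(Ω, P)`: each `N ω` is a measure, `N(B)` is a Poisson random variable with mean `μ(B)`,
and the values on pairwise disjoint sets are independent. -/
structure IsPoissonRandomMeasure {Ω E : Type*} [MeasurableSpace Ω] [MeasurableSpace E]
    (N : Ω → Measure E) (μ : Measure E) (P : Measure Ω) : Prop where
  measurable : ∀ B : Set E, MeasurableSet B → Measurable (fun ω => N ω B)
  law : ∀ B : Set E, MeasurableSet B → P.map (fun ω => N ω B) = poissonLaw (μ B)
  indep : ∀ (m : ℕ) (B : Fin m → Set E), (∀ k, MeasurableSet (B k)) →
    Pairwise (fun k l => Disjoint (B k) (B l)) → iIndepFun (fun k ω => N ω (B k)) P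

/-- The strip `[0, 1] × ℝ` on which the Lévy basis lives; `volume` is Lebesgue measure. -/
abbrev Strip : Type := unitInterval × ℝ

/-- A Lévy measure concentrated on `ℤⁿ \ {0}` with `∫ min(1, ‖y‖) ν(dy) < ∞`. -/
structure IsIntegerLevyMeasure {n : ℕ} (ν : Measure (EuclideanSpace ℝ (Fin n))) : Prop where
  concentrated : ν {y | y ≠ 0 ∧ ∀ k, ∃ m : ℤ, y k = m}ᶜ = 0
  integrable_min : ∫⁻ y, min 1 ‖y‖ₑ ∂ν < ∞

/-- The homogeneous intensity measure `ν(dy) dx ds` on `ℝⁿ × [0, 1] × ℝ`. -/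
def intensity {n : ℕ} (ν : Measure (EuclideanSpace ℝ (Fin n))) :
    Measure (EuclideanSpace ℝ (Fin n) × Strip) :=
  ν.prod volume

/-- The `i`-th component of the Lévy basis, `L⁽ⁱ⁾(B) = ∫_{ℝⁿ × B} yᵢ N(dy, dx, ds)`. -/
def levyBasis {Ω : Type*} {n : ℕ} (N : Ω → Measure (EuclideanSpace ℝ (Fin n) × Strip))
    (i : Fin n) (B : Set Strip) (ω : Ω) : ℝ :=
  ∫ e in Set.univ ×ˢ B, e.1 i ∂(N ω)

/-- The random vector `L'` is a Lévy seed for `ν`: its cumulant function is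
`θ ↦ ∫ (exp(i θᵀy) - 1) ν(dy)`. -/
structure IsLevySeed {Ω' : Type*} [MeasurableSpace Ω'] {n : ℕ}
    (L' : Ω' → EuclideanSpace ℝ (Fin n)) (ν : Measure (EuclideanSpace ℝ (Fin n)))
    (P' : Measure Ω') : Prop where
  aemeasurable : AEMeasurable L' P'
  charFun_eq : ∀ θ : EuclideanSpace ℝ (Fin n), charFun (P'.map L') θ =
    Complex.exp (∫ y, (Complex.exp (Complex.I * ((inner ℝ θ y : ℝ) : ℂ)) - 1) ∂ν)

/-- A trawl: a Borel subset of `[0, 1] × (-∞, 0]` of finite Lebesgue measure. -/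
structure IsTrawl (A : Set Strip) : Prop where
  measurableSet : MeasurableSet A
  subset : ∀ p ∈ A, p.2 ≤ 0
  volume_lt_top : volume A < ∞

/-- The trawl at time `t`, `A_t = A + (0, t)`. -/
def shift (A : Set Strip) (t : ℝ) : Set Strip := {p | (p.1, p.2 - t) ∈ A}

/-- The `i`-th component `Y⁽ⁱ⁾_t = L⁽ⁱ⁾(A⁽ⁱ⁾_t)` of the multivariate trawl process. -/
def trawlProcess {Ω : Type*} {n : ℕ} (N : Ω → Measure (EuclideanSpace ℝ (Fin n) × Strip))
    (A : Fin n → Set Strip) (i : Fin n) (t : ℝ) (ω : Ω) : ℝ :=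
  levyBasis N i (shift (A i) t) ω

/-- The joint Lévy measure `ν⁽ⁱʲ⁾` of components `i` and `j`: the image of `ν` under
`y ↦ (yᵢ, yⱼ)`. -/
def jointLevyMeasure {n : ℕ} (ν : Measure (EuclideanSpace ℝ (Fin n))) (i j : Fin n) :
    Measure (ℝ × ℝ) :=
  ν.map (fun y => (y i, y j))

/-- `κ_{i,j} = ∫∫ yᵢ yⱼ ν⁽ⁱʲ⁾(dyᵢ, dyⱼ)`. -/
def kappa {n : ℕ} (ν : Measure (EuclideanSpace ℝ (Fin n))) (i j : Fin n) : ℝ :=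
  ∫ p, p.1 * p.2 ∂(jointLevyMeasure ν i j)

/-- The autocorrelator `R_{ij}(h) = Leb(A⁽ⁱ⁾ ∩ A⁽ʲ⁾_h)`. -/
def autocorrelator {n : ℕ} (A : Fin n → Set Strip) (i j : Fin n) (h : ℝ) : ℝ :=
  volume.real (A i ∩ shift (A j) h)

/-- The correlation `Cov(X, Y) / √(Var X · Var Y)`. -/
def correlation {Ω : Type*} [MeasurableSpace Ω] (X Y : Ω → ℝ) (P : Measure Ω) : ℝ :=
  covariance X Y P / Real.sqrt (variance X P * variance Y P)

end TrawlProcess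

end

/-! ### Poisson moments and Campbell formulas for nonnegative functions -/

namespace TrawlProcess

/-! Each `Y⁽ⁱ⁾_t` is the integral against `N` of the product function `yᵢ · 1_B(x, s)` with `B =
A⁽ⁱ⁾_t`. For a Poisson random measure with intensity `μ`, the covariance of `∫ f dN` and `∫ g dN` is
`∫ f g dμ` (`covariance_integral`). Since `μ = ν ⊗ Leb`, this integral factors as `κ_{i,j}` times
the measure of the intersection of the two shifted trawls, and translation invariance removes `t`.

The covariance identity rests on `E[N(B) N(C)] = μ(B ∩ C) + μ(B) μ(C)`, which follows from Poisson
second moments and independence on disjoint sets. It is extended to functions in one argument at a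
time, as an equality of mean measures in `[0, ∞]`, and then to real integrands through positive and
negative parts.

The seed `L'` is known only through its characteristic function, so `Var(L'⁽ⁱ⁾) = κ_{i,i}` is a
separate analytic fact (`memLp_and_variance_of_charFun`). For an independent copy `X'` of `X`, the
characteristic function of `X - X'` is `|φ|²`. The limit of `(1 - |φ(t)|²) / t²` at `0` gives square
integrability by Fatou's lemma, and then the variance by dominated convergence. -/

/-- The Stein–Chen identity, from `(k + 1) p(k + 1) = r p(k)` for the Poisson weights. Taking `g =
1` and `g(k) = k` yields the first two moments. -/
lemma lintegral_poissonMeasure_nat_mul (r : ℝ≥0) (g : ℕ → ℝ≥0∞) :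
    ∫⁻ k, (k : ℝ≥0∞) * g k ∂(poissonMeasure r) =
      r * ∫⁻ k, g (k + 1) ∂(poissonMeasure r) := by
  rw [lintegral_countable', lintegral_countable', tsum_eq_zero_add' ENNReal.summable,
    ← ENNReal.tsum_mul_left]
  simp only [Nat.cast_zero, zero_mul, zero_add]
  refine tsum_congr fun k => ?_
  have key : ((k + 1 : ℕ) : ℝ≥0∞) * poissonMeasure r {k + 1} = r * poissonMeasure r {k} := by
    rw [poissonMeasure_singleton, poissonMeasure_singleton, ← ENNReal.ofReal_natCast,
      ← ENNReal.ofReal_coe_nnreal, ← ENNReal.ofReal_mul (by positivity),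
      ← ENNReal.ofReal_mul (by positivity), Nat.factorial_succ]
    congr 1
    push_cast
    field_simp
    ring
  calc ((k + 1 : ℕ) : ℝ≥0∞) * g (k + 1) * poissonMeasure r {k + 1}
      = g (k + 1) * (((k + 1 : ℕ) : ℝ≥0∞) * poissonMeasure r {k + 1}) := by ring
    _ = r * (g (k + 1) * poissonMeasure r {k}) := by rw [key]; ring

lemma lintegral_poissonLaw (c : ℝ≥0∞) : ∫⁻ x, x ∂(poissonLaw c) = c := by
  unfold poissonLaw
  split_ifs with h
  · simp [h]
  · rw [lintegral_map (by fun_prop) (Measurable.of_discrete)]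
    have := lintegral_poissonMeasure_nat_mul c.toNNReal 1
    simpa [ENNReal.coe_toNNReal h] using this

lemma lintegral_sq_poissonLaw (c : ℝ≥0∞) : ∫⁻ x, x * x ∂(poissonLaw c) = c + c * c := by
  unfold poissonLaw
  split_ifs with h
  · simp [h]
  · rw [lintegral_map (by fun_prop) (Measurable.of_discrete)]
    have h1 := lintegral_poissonMeasure_nat_mul c.toNNReal 1
    rw [lintegral_poissonMeasure_nat_mul]
    simp only [Pi.one_apply, mul_one, lintegral_one, measure_univ] at h1
    simp only [Nat.cast_add, Nat.cast_one]
    rw [lintegral_add_right _ measurable_const, h1]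
    simp [ENNReal.coe_toNNReal h]
    ring

namespace IsPoissonRandomMeasure

variable {Ω E : Type*} [MeasurableSpace Ω] [MeasurableSpace E]
  {N : Ω → Measure E} {μ : Measure E} {P : Measure Ω}

lemma measurable_measure (hN : IsPoissonRandomMeasure N μ P) : Measurable N :=
  Measure.measurable_of_measurable_coe N hN.measurable

lemma measurable_lintegral (hN : IsPoissonRandomMeasure N μ P) {f : E → ℝ≥0∞}
    (hf : Measurable f) : Measurable fun ω => ∫⁻ e, f e ∂(N ω) :=
  (Measure.measurable_lintegral hf).comp hN.measurable_measure

lemma lintegral_measure (hN : IsPoissonRandomMeasure N μ P) {B : Set E}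
    (hB : MeasurableSet B) : ∫⁻ ω, N ω B ∂P = μ B := by
  rw [← lintegral_poissonLaw (μ B), ← hN.law B hB,
    lintegral_map (by fun_prop) (hN.measurable B hB)]

lemma lintegral_measure_mul_self (hN : IsPoissonRandomMeasure N μ P) {B : Set E}
    (hB : MeasurableSet B) : ∫⁻ ω, N ω B * N ω B ∂P = μ B + μ B * μ B := by
  rw [← lintegral_sq_poissonLaw (μ B), ← hN.law B hB,
    lintegral_map (by fun_prop) (hN.measurable B hB)]

lemma lintegral_measure_mul_of_disjoint (hN : IsPoissonRandomMeasure N μ P) {B C : Set E}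
    (hB : MeasurableSet B) (hC : MeasurableSet C) (h : Disjoint B C) :
    ∫⁻ ω, N ω B * N ω C ∂P = μ B * μ C := by
  have hi := hN.indep 2 ![B, C] (by intro k; fin_cases k <;> simpa)
    (by intro k l hkl; fin_cases k <;> fin_cases l <;> simp_all [disjoint_comm])
  have h2 : IndepFun (fun ω => N ω B) (fun ω => N ω C) P :=
    hi.indepFun (i := 0) (j := 1) (by simp)
  rw [← hN.lintegral_measure hB, ← hN.lintegral_measure hC]
  exact lintegral_mul_eq_lintegral_mul_lintegral_of_indepFun (hN.measurable B hB)
    (hN.measurable C hC) h2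

lemma lintegral_measure_mul_measure (hN : IsPoissonRandomMeasure N μ P) {B C : Set E}
    (hB : MeasurableSet B) (hC : MeasurableSet C) :
    ∫⁻ ω, N ω C * N ω B ∂P = μ (C ∩ B) + μ C * μ B := by
  -- Cut both sets along `C ∩ B` using sums only, as values may be infinite. Every product is then a
  -- square or involves disjoint sets. The identity is used for `N ω` and for `μ` alike.
  have hs : ∀ m : Measure E, m C * m B = m (C ∩ B) * m (C ∩ B) + m (C ∩ B) * m (B \ C) +
      m (C \ B) * m B := fun m => by
    conv_lhs => rw [← measure_inter_add_sdiff C hB]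
    rw [add_mul, ← mul_add, Set.inter_comm C B, measure_inter_add_sdiff B hC]
  simp_rw [hs]
  have hm := hN.measurable
  have m1 := hm _ (hC.inter hB)
  have m2 := hm _ (hB.diff hC)
  have m3 := hm _ (hC.diff hB)
  have m4 := hm _ hB
  rw [lintegral_add_left (by fun_prop), lintegral_add_left (by fun_prop),
    hN.lintegral_measure_mul_self (hC.inter hB),
    hN.lintegral_measure_mul_of_disjoint (hC.inter hB) (hB.diff hC)
      (Set.disjoint_left.2 fun x hx hx' => hx'.2 hx.1),
    hN.lintegral_measure_mul_of_disjoint (hC.diff hB) hB Set.disjoint_sdiff_left]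
  ring

lemma bind_eq (hN : IsPoissonRandomMeasure N μ P) : P.bind N = μ := by
  ext B hB
  rw [Measure.bind_apply hB hN.measurable_measure.aemeasurable, hN.lintegral_measure hB]

/-- Campbell's formula. -/
lemma lintegral_lintegral (hN : IsPoissonRandomMeasure N μ P) {f : E → ℝ≥0∞}
    (hf : Measurable f) : ∫⁻ ω, ∫⁻ e, f e ∂(N ω) ∂P = ∫⁻ e, f e ∂μ := by
  conv_rhs => rw [← hN.bind_eq]
  rw [Measure.lintegral_bind hN.measurable_measure.aemeasurable hf.aemeasurable]

/-- Weighting `P` by `N(C)` turns the mean measure of `N` into `μ|_C + μ(C) μ`; the preceding lemma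
checks this on sets, and integrating `f` against both sides gives the claim. -/
lemma lintegral_measure_mul_lintegral (hN : IsPoissonRandomMeasure N μ P) {C : Set E}
    (hC : MeasurableSet C) {f : E → ℝ≥0∞} (hf : Measurable f) :
    ∫⁻ ω, N ω C * ∫⁻ e, f e ∂(N ω) ∂P = ∫⁻ e in C, f e ∂μ + μ C * ∫⁻ e, f e ∂μ := by
  have key : (P.withDensity fun ω => N ω C).bind N = μ.restrict C + μ C • μ := by
    ext B hB
    rw [Measure.bind_apply hB hN.measurable_measure.aemeasurable,
      lintegral_withDensity_eq_lintegral_mul _ (hN.measurable C hC) (hN.measurable B hB)]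
    simpa [Measure.restrict_apply hB, Set.inter_comm] using hN.lintegral_measure_mul_measure hB hC
  have := congrArg (fun m => ∫⁻ e, f e ∂m) key
  rw [Measure.lintegral_bind hN.measurable_measure.aemeasurable hf.aemeasurable,
    lintegral_withDensity_eq_lintegral_mul _ (hN.measurable C hC) (hN.measurable_lintegral hf),
    lintegral_add_measure, lintegral_smul_measure] at this
  simpa using this

/-- The second-order Campbell formula. -/
lemma lintegral_lintegral_mul_lintegral (hN : IsPoissonRandomMeasure N μ P) {f g : E → ℝ≥0∞}
    (hf : Measurable f) (hg : Measurable g) :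
    ∫⁻ ω, (∫⁻ e, f e ∂(N ω)) * ∫⁻ e, g e ∂(N ω) ∂P =
      ∫⁻ e, f e * g e ∂μ + (∫⁻ e, f e ∂μ) * ∫⁻ e, g e ∂μ := by
  -- The same argument with weight `∫ f dN`: the previous lemma, with `f` in one slot and a set in
  -- the other, identifies the mean measure.
  have key : (P.withDensity fun ω => ∫⁻ e, f e ∂(N ω)).bind N =
      μ.withDensity f + (∫⁻ e, f e ∂μ) • μ := by
    ext B hB
    rw [Measure.bind_apply hB hN.measurable_measure.aemeasurable,
      lintegral_withDensity_eq_lintegral_mul _ (hN.measurable_lintegral hf) (hN.measurable B hB)]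
    simpa [withDensity_apply _ hB, mul_comm] using hN.lintegral_measure_mul_lintegral hB hf
  have := congrArg (fun m => ∫⁻ e, g e ∂m) key
  rw [Measure.lintegral_bind hN.measurable_measure.aemeasurable hg.aemeasurable,
    lintegral_withDensity_eq_lintegral_mul _ (hN.measurable_lintegral hf)
      (hN.measurable_lintegral hg),
    lintegral_add_measure, lintegral_smul_measure,
    lintegral_withDensity_eq_lintegral_mul _ hf hg] at this
  simpa using this

end IsPoissonRandomMeasure

end TrawlProcess

/-! ### Campbell formulas and covariance for real integrands -/

namespace TrawlProcess

namespace IsPoissonRandomMeasure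

variable {Ω E : Type*} [MeasurableSpace Ω] [MeasurableSpace E]
  {N : Ω → Measure E} {μ : Measure E} {P : Measure Ω}

lemma ae_integrable (hN : IsPoissonRandomMeasure N μ P) {f : E → ℝ} (hf : Measurable f)
    (hi : Integrable f μ) : ∀ᵐ ω ∂P, Integrable f (N ω) := by
  have h : ∫⁻ ω, ∫⁻ e, ‖f e‖ₑ ∂(N ω) ∂P ≠ ∞ := by
    rw [hN.lintegral_lintegral hf.enorm]
    exact hi.2.ne
  filter_upwards [ae_lt_top (hN.measurable_lintegral hf.enorm) h] with ω hω
  exact ⟨hf.aestronglyMeasurable, hω⟩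

lemma integral_of_nonneg {m : Measure E} {f : E → ℝ} (hf : Measurable f) (h0 : 0 ≤ f) :
    ∫ e, f e ∂m = (∫⁻ e, ENNReal.ofReal (f e) ∂m).toReal :=
  integral_eq_lintegral_of_nonneg_ae (ae_of_all _ h0) hf.aestronglyMeasurable

lemma integrable_integral_of_nonneg (hN : IsPoissonRandomMeasure N μ P) {f : E → ℝ}
    (hf : Measurable f) (h0 : 0 ≤ f) (hi : Integrable f μ) :
    Integrable (fun ω => ∫ e, f e ∂(N ω)) P ∧
      ∫ ω, ∫ e, f e ∂(N ω) ∂P = ∫ e, f e ∂μ := by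
  have hm := hN.measurable_lintegral hf.ennreal_ofReal
  have he := hN.lintegral_lintegral hf.ennreal_ofReal
  have ht : ∫⁻ e, ENNReal.ofReal (f e) ∂μ ≠ ∞ := hi.lintegral_lt_top.ne
  simp_rw [integral_of_nonneg hf h0]
  refine ⟨integrable_toReal_of_lintegral_ne_top hm.aemeasurable (he ▸ ht), ?_⟩
  rw [integral_toReal hm.aemeasurable (ae_lt_top hm (he ▸ ht)), he]

lemma integrable_integral_mul_of_nonneg (hN : IsPoissonRandomMeasure N μ P) {f g : E → ℝ}
    (hf : Measurable f) (f0 : 0 ≤ f) (hi : Integrable f μ)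
    (hg : Measurable g) (g0 : 0 ≤ g) (hj : Integrable g μ)
    (hij : Integrable (fun e => f e * g e) μ) :
    Integrable (fun ω => (∫ e, f e ∂(N ω)) * ∫ e, g e ∂(N ω)) P ∧
      ∫ ω, (∫ e, f e ∂(N ω)) * ∫ e, g e ∂(N ω) ∂P =
        ∫ e, f e * g e ∂μ + (∫ e, f e ∂μ) * ∫ e, g e ∂μ := by
  have hm := (hN.measurable_lintegral hf.ennreal_ofReal).mul
    (hN.measurable_lintegral hg.ennreal_ofReal)
  have he := hN.lintegral_lintegral_mul_lintegral hf.ennreal_ofReal hg.ennreal_ofReal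
  simp_rw [← ENNReal.ofReal_mul (f0 _)] at he
  have t1 : ∫⁻ e, ENNReal.ofReal (f e) ∂μ ≠ ∞ := hi.lintegral_lt_top.ne
  have t2 : ∫⁻ e, ENNReal.ofReal (g e) ∂μ ≠ ∞ := hj.lintegral_lt_top.ne
  have t3 : ∫⁻ e, ENNReal.ofReal (f e * g e) ∂μ ≠ ∞ := hij.lintegral_lt_top.ne
  have t4 := ENNReal.mul_ne_top t1 t2
  simp_rw [integral_of_nonneg hf f0, integral_of_nonneg hg g0,
    integral_of_nonneg (f := fun e => f e * g e) (hf.mul hg) (fun e => mul_nonneg (f0 e) (g0 e)),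
    ← ENNReal.toReal_mul]
  have ht := he ▸ ENNReal.add_ne_top.2 ⟨t3, t4⟩
  refine ⟨integrable_toReal_of_lintegral_ne_top hm.aemeasurable ht, ?_⟩
  rw [← ENNReal.toReal_add t3 t4, ← he]
  exact integral_toReal hm.aemeasurable (ae_lt_top hm ht)

/-- The equality is only almost sure: where `f` is not `N ω`-integrable the left integral takes the
default value `0`. -/
lemma ae_integral_eq_sub (hN : IsPoissonRandomMeasure N μ P) {f : E → ℝ}
    (hf : Measurable f) (hi : Integrable f μ) :
    (fun ω => ∫ e, f e ∂(N ω)) =ᵐ[P]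
      fun ω => ∫ e, max (f e) 0 ∂(N ω) - ∫ e, max (-f e) 0 ∂(N ω) := by
  filter_upwards [hN.ae_integrable hf hi] with ω hω
  rw [← integral_sub hω.pos_part hω.neg_part]
  exact integral_congr_ae (ae_of_all _ fun e => (max_zero_sub_max_neg_zero_eq_self _).symm)

lemma integrable_integral (hN : IsPoissonRandomMeasure N μ P) {f : E → ℝ}
    (hf : Measurable f) (hi : Integrable f μ) :
    Integrable (fun ω => ∫ e, f e ∂(N ω)) P ∧
      ∫ ω, ∫ e, f e ∂(N ω) ∂P = ∫ e, f e ∂μ := by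
  obtain ⟨i1, e1⟩ := hN.integrable_integral_of_nonneg (f := fun e => max (f e) 0)
    (by fun_prop) (fun e => le_max_right _ _) hi.pos_part
  obtain ⟨i2, e2⟩ := hN.integrable_integral_of_nonneg (f := fun e => max (-f e) 0)
    (by fun_prop) (fun e => le_max_right _ _) hi.neg_part
  have hae := hN.ae_integral_eq_sub hf hi
  refine ⟨(i1.sub i2).congr hae.symm, ?_⟩
  rw [integral_congr_ae hae, integral_sub i1 i2, e1, e2, ← integral_sub hi.pos_part hi.neg_part]
  exact integral_congr_ae (ae_of_all _ fun e => max_zero_sub_max_neg_zero_eq_self _)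

lemma integrable_integral_mul (hN : IsPoissonRandomMeasure N μ P) {f g : E → ℝ}
    (hf : Measurable f) (hi : Integrable f μ) (hg : Measurable g) (hj : Integrable g μ)
    (hij : Integrable (fun e => f e * g e) μ) :
    Integrable (fun ω => (∫ e, f e ∂(N ω)) * ∫ e, g e ∂(N ω)) P ∧
      ∫ ω, (∫ e, f e ∂(N ω)) * ∫ e, g e ∂(N ω) ∂P =
        ∫ e, f e * g e ∂μ + (∫ e, f e ∂μ) * ∫ e, g e ∂μ := by
  -- Each of the four products of positive and negative parts is dominated by `|f g|`.
  have hle : ∀ {u v : E → ℝ}, Measurable u → Measurable v → (∀ e, |u e| ≤ |f e|) →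
      (∀ e, |v e| ≤ |g e|) → Integrable (fun e => u e * v e) μ := fun hu hv h1 h2 =>
    hij.mono (hu.mul hv).aestronglyMeasurable (ae_of_all _ fun e => by
      simpa only [Real.norm_eq_abs, abs_mul] using
        mul_le_mul (h1 e) (h2 e) (abs_nonneg _) (abs_nonneg _))
  have hp : ∀ x : ℝ, |max x 0| ≤ |x| := fun x => by
    rw [abs_of_nonneg (le_max_right _ _)]; exact max_le (le_abs_self _) (abs_nonneg _)
  have hn : ∀ x : ℝ, |max (-x) 0| ≤ |x| := fun x => abs_neg x ▸ hp (-x)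
  have f1 : Measurable fun e => max (f e) 0 := by fun_prop
  have f2 : Measurable fun e => max (-f e) 0 := by fun_prop
  have g1 : Measurable fun e => max (g e) 0 := by fun_prop
  have g2 : Measurable fun e => max (-g e) 0 := by fun_prop
  have z : ∀ u : E → ℝ, (0 : E → ℝ) ≤ fun e => max (u e) 0 := fun u e => le_max_right _ _
  have j11 := hle f1 g1 (fun e => hp _) (fun e => hp _)
  have j12 := hle f1 g2 (fun e => hp _) (fun e => hn _)
  have j21 := hle f2 g1 (fun e => hn _) (fun e => hp _)
  have j22 := hle f2 g2 (fun e => hn _) (fun e => hn _)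
  obtain ⟨i11, e11⟩ := hN.integrable_integral_mul_of_nonneg f1 (z _) hi.pos_part g1 (z _)
    hj.pos_part j11
  obtain ⟨i12, e12⟩ := hN.integrable_integral_mul_of_nonneg f1 (z _) hi.pos_part g2 (z _)
    hj.neg_part j12
  obtain ⟨i21, e21⟩ := hN.integrable_integral_mul_of_nonneg f2 (z _) hi.neg_part g1 (z _)
    hj.pos_part j21
  obtain ⟨i22, e22⟩ := hN.integrable_integral_mul_of_nonneg f2 (z _) hi.neg_part g2 (z _)
    hj.neg_part j22
  have hae : (fun ω => (∫ e, f e ∂(N ω)) * ∫ e, g e ∂(N ω)) =ᵐ[P] fun ω =>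
      ((∫ e, max (f e) 0 ∂(N ω)) * (∫ e, max (g e) 0 ∂(N ω)) -
        (∫ e, max (f e) 0 ∂(N ω)) * ∫ e, max (-g e) 0 ∂(N ω)) -
      ((∫ e, max (-f e) 0 ∂(N ω)) * (∫ e, max (g e) 0 ∂(N ω)) -
        (∫ e, max (-f e) 0 ∂(N ω)) * ∫ e, max (-g e) 0 ∂(N ω)) := by
    filter_upwards [hN.ae_integral_eq_sub hf hi, hN.ae_integral_eq_sub hg hj] with ω h1 h2
    rw [h1, h2]
    ring
  refine ⟨((i11.sub i12).sub (i21.sub i22)).congr hae.symm, ?_⟩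
  have hfs : ∫ e, f e ∂μ = ∫ e, max (f e) 0 ∂μ - ∫ e, max (-f e) 0 ∂μ := by
    rw [← integral_sub hi.pos_part hi.neg_part]
    exact integral_congr_ae (ae_of_all _ fun e => (max_zero_sub_max_neg_zero_eq_self _).symm)
  have hgs : ∫ e, g e ∂μ = ∫ e, max (g e) 0 ∂μ - ∫ e, max (-g e) 0 ∂μ := by
    rw [← integral_sub hj.pos_part hj.neg_part]
    exact integral_congr_ae (ae_of_all _ fun e => (max_zero_sub_max_neg_zero_eq_self _).symm)
  have hfg : ∫ e, f e * g e ∂μ =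
      (∫ e, max (f e) 0 * max (g e) 0 ∂μ - ∫ e, max (f e) 0 * max (-g e) 0 ∂μ) -
      (∫ e, max (-f e) 0 * max (g e) 0 ∂μ - ∫ e, max (-f e) 0 * max (-g e) 0 ∂μ) := by
    rw [← integral_sub j11 j12, ← integral_sub j21 j22, 
      ← integral_sub (by exact j11.sub j12) (by exact j21.sub j22)]
    refine integral_congr_ae (ae_of_all _ fun e => ?_)
    have h1 := max_zero_sub_max_neg_zero_eq_self (f e)
    have h2 := max_zero_sub_max_neg_zero_eq_self (g e)
    simp only
    conv_lhs => rw [← h1, ← h2]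
    ring
  rw [integral_congr_ae hae, integral_sub (by exact i11.sub i12) (by exact i21.sub i22), integral_sub i11 i12,
    integral_sub i21 i22, e11, e12, e21, e22, hfg, hfs, hgs]
  ring

/-- The covariance of two integrals against a Poisson random measure. -/
lemma covariance_integral [IsProbabilityMeasure P] (hN : IsPoissonRandomMeasure N μ P)
    {f g : E → ℝ} (hf : Measurable f) (hi : Integrable f μ) (hg : Measurable g)
    (hj : Integrable g μ) (hij : Integrable (fun e => f e * g e) μ) :
    covariance (fun ω => ∫ e, f e ∂(N ω)) (fun ω => ∫ e, g e ∂(N ω)) P =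
      ∫ e, f e * g e ∂μ := by
  obtain ⟨i1, e1⟩ := hN.integrable_integral hf hi
  obtain ⟨i2, e2⟩ := hN.integrable_integral hg hj
  obtain ⟨i3, e3⟩ := hN.integrable_integral_mul hf hi hg hj hij
  unfold covariance
  rw [e1, e2]
  set a := ∫ e, f e ∂μ
  set b := ∫ e, g e ∂μ
  have hs : ∀ ω, ((∫ e, f e ∂(N ω)) - a) * ((∫ e, g e ∂(N ω)) - b) =
      (∫ e, f e ∂(N ω)) * (∫ e, g e ∂(N ω)) - b * (∫ e, f e ∂(N ω)) -
        a * (∫ e, g e ∂(N ω)) + a * b := fun ω => by ring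
  simp_rw [hs]
  rw [integral_add (by exact (i3.sub (i1.const_mul b)).sub (i2.const_mul a)) (integrable_const _),
    integral_sub (by exact i3.sub (i1.const_mul b)) (i2.const_mul a), integral_sub i3 (i1.const_mul b),
    integral_const_mul, integral_const_mul, e1, e2, e3]
  simp
  ring

end IsPoissonRandomMeasure

end TrawlProcess

/-! ### Second moments from characteristic functions -/

namespace TrawlProcess

open Filter Topology

lemma tendsto_one_sub_cos_div (x : ℝ) :
    Tendsto (fun t => (1 - Real.cos (t * x)) / t ^ 2) (𝓝[≠] 0) (𝓝 (x ^ 2 / 2)) := by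
  have h : Tendsto (fun t : ℝ => x ^ 2 / 2 * Real.sinc (t * x / 2) ^ 2) (𝓝[≠] 0)
      (𝓝 (x ^ 2 / 2)) := by
    have hc : Continuous fun t : ℝ => x ^ 2 / 2 * Real.sinc (t * x / 2) ^ 2 := by
      have := Real.continuous_sinc
      fun_prop
    simpa using (hc.tendsto 0).mono_left nhdsWithin_le_nhds
  refine h.congr' ?_
  filter_upwards [self_mem_nhdsWithin] with t ht
  have ht : t ≠ 0 := ht
  have hs : Real.sin (t * x / 2) = t * x / 2 * Real.sinc (t * x / 2) := by
    by_cases h0 : t * x / 2 = 0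
    · simp [h0]
    · rw [Real.sinc_of_ne_zero h0, mul_div_cancel₀ _ h0]
  have hcos : 1 - Real.cos (t * x) = 2 * Real.sin (t * x / 2) ^ 2 := by
    have := Real.cos_sq' (t * x / 2)
    have h2 := Real.cos_sq (t * x / 2)
    rw [show 2 * (t * x / 2) = t * x by ring] at h2
    linarith
  rw [hcos, hs]
  field_simp

lemma one_sub_cos_div_nonneg (t x : ℝ) : 0 ≤ (1 - Real.cos (t * x)) / t ^ 2 :=
  div_nonneg (sub_nonneg.2 (Real.cos_le_one _)) (sq_nonneg _)

lemma one_sub_cos_div_le (t x : ℝ) : (1 - Real.cos (t * x)) / t ^ 2 ≤ x ^ 2 / 2 := by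
  by_cases ht : t = 0
  · simp only [ht, zero_mul, Real.cos_zero, sub_self, zero_div]
    positivity
  · rw [div_le_iff₀ (by positivity)]
    have := Real.one_sub_sq_div_two_le_cos (x := t * x)
    linarith [mul_pow t x 2]

variable {α : Type*} [MeasurableSpace α] {m : Measure α} {X : α → ℝ}

lemma tendsto_integral_one_sub_cos_div (hX : AEMeasurable X m)
    (hi : Integrable (fun a => X a ^ 2) m) :
    Tendsto (fun t => ∫ a, (1 - Real.cos (t * X a)) / t ^ 2 ∂m) (𝓝[≠] 0)
      (𝓝 (∫ a, X a ^ 2 / 2 ∂m)) := by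
  refine tendsto_integral_filter_of_dominated_convergence (fun a => X a ^ 2 / 2)
    (.of_forall fun t => AEMeasurable.aestronglyMeasurable (by fun_prop))
    (.of_forall fun t => ae_of_all _ fun a => ?_) (hi.div_const 2)
    (ae_of_all _ fun a => tendsto_one_sub_cos_div _)
  rw [Real.norm_of_nonneg (one_sub_cos_div_nonneg _ _)]
  exact one_sub_cos_div_le _ _

/-- Fatou's lemma along `t → 0`: the nonnegative quotients converge pointwise to `X² / 2`, and their
integrals have a finite limit. -/
lemma integrable_sq_of_tendsto [IsFiniteMeasure m] (hX : AEMeasurable X m) {c : ℝ}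
    (h : Tendsto (fun t => ∫ a, (1 - Real.cos (t * X a)) / t ^ 2 ∂m) (𝓝[≠] 0) (𝓝 c)) :
    Integrable (fun a => X a ^ 2) m := by
  have hm : ∀ t : ℝ, AEMeasurable (fun a => (1 - Real.cos (t * X a)) / t ^ 2) m :=
    fun t => by fun_prop
  have hint : ∀ t : ℝ, Integrable (fun a => (1 - Real.cos (t * X a)) / t ^ 2) m := fun t =>
    Integrable.of_bound (hm t).aestronglyMeasurable (2 / t ^ 2) (ae_of_all _ fun a => by
      rw [Real.norm_of_nonneg (one_sub_cos_div_nonneg _ _)]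
      gcongr
      linarith [Real.neg_one_le_cos (t * X a)])
  have hf := lintegral_liminf_le' (u := 𝓝[≠] (0 : ℝ)) fun t => (hm t).ennreal_ofReal
  have h1 : ∀ a, liminf (fun t : ℝ => ENNReal.ofReal ((1 - Real.cos (t * X a)) / t ^ 2)) (𝓝[≠] 0) =
      ENNReal.ofReal (X a ^ 2 / 2) := fun a =>
    (ENNReal.tendsto_ofReal (tendsto_one_sub_cos_div (X a))).liminf_eq
  simp_rw [h1, ← ofReal_integral_eq_lintegral_ofReal (hint _)
    (ae_of_all _ fun a => one_sub_cos_div_nonneg _ _), (ENNReal.tendsto_ofReal h).liminf_eq] at hf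
  have h2 : Integrable (fun a => X a ^ 2 / 2) m := by
    refine ⟨AEMeasurable.aestronglyMeasurable (by fun_prop), ?_⟩
    rw [hasFiniteIntegral_iff_ofReal (ae_of_all _ fun a => by positivity)]
    exact hf.trans_lt ENNReal.ofReal_lt_top
  simpa using h2.mul_const 2

/-- By Fubini some value `X a` of the second copy leaves `X - X a` square integrable; adding back
the constant undoes the symmetrisation. -/
lemma memLp_two_of_integrable_sub_sq [IsProbabilityMeasure m] (hX : AEMeasurable X m)
    (h : Integrable (fun p : α × α => (X p.1 - X p.2) ^ 2) (m.prod m)) : MemLp X 2 m := by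
  obtain ⟨a, ha⟩ := h.prod_left_ae.exists
  have h1 : MemLp (fun b => X b - X a) 2 m :=
    (memLp_two_iff_integrable_sq (by fun_prop)).2 ha
  refine (memLp_congr_ae (ae_of_all _ fun b => ?_)).1 (h1.add (memLp_const (X a)))
  simp

lemma integral_sub_sq [IsProbabilityMeasure m] (hX : MemLp X 2 m) :
    ∫ p : α × α, (X p.1 - X p.2) ^ 2 ∂(m.prod m) = 2 * variance X m := by
  have h := variance_add_prod hX hX.neg
  rw [variance_neg] at h
  have h0 : ∫ p : α × α, X p.1 + (-X) p.2 ∂(m.prod m) = 0 := by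
    have i1 := (hX.integrable one_le_two)
    rw [integral_add (i1.comp_fst m) (i1.neg.comp_snd m), integral_fun_fst, integral_fun_snd]
    simp [integral_neg]
  rw [two_mul, ← h, variance_of_integral_eq_zero _ h0]
  · simp [sub_eq_add_neg]
  · have := hX.aemeasurable
    exact (this.comp_fst).add (this.neg.comp_snd)

/-- The characteristic function of `X - X'`, with `X'` an independent copy, is `φ · conj φ`; its
real part is the mean of the cosine. -/
lemma integral_cos_sub [IsProbabilityMeasure m] (hX : AEMeasurable X m) (t : ℝ) :
    ∫ p : α × α, Real.cos (t * (X p.1 - X p.2)) ∂(m.prod m) =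
      Complex.normSq (∫ a, Complex.exp (t * X a * Complex.I) ∂m) := by
  have h1 := integral_prod_mul (μ := m) (ν := m) (fun a => Complex.exp (t * X a * Complex.I))
    (fun a => (starRingEnd ℂ) (Complex.exp (t * X a * Complex.I)))
  rw [integral_conj, Complex.mul_conj] at h1
  have h2 := congrArg Complex.re h1
  rw [Complex.ofReal_re] at h2
  rw [← h2, ← Complex.reCLM_apply, ← ContinuousLinearMap.integral_comp_comm]
  · refine integral_congr_ae (ae_of_all _ fun p => ?_)
    simp only [Complex.reCLM_apply]
    rw [← Complex.exp_conj, ← Complex.exp_add, ← Complex.exp_ofReal_mul_I_re]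
    congr 2
    simp
    ring
  · refine Integrable.of_bound (AEMeasurable.aestronglyMeasurable ?_) 1 (ae_of_all _ fun p => ?_)
    · have := hX.comp_fst (ν := m)
      have := hX.comp_snd (μ := m)
      simp_rw [← Complex.exp_conj, ← Complex.exp_add, map_mul, Complex.conj_ofReal]
      fun_prop
    · rw [norm_mul, RCLike.norm_conj]
      have : ∀ a, ‖Complex.exp (t * X a * Complex.I)‖ = 1 := fun a => by
        exact_mod_cast Complex.norm_exp_ofReal_mul_I (t * X a)
      rw [this, this, one_mul]

lemma tendsto_one_sub_exp_div {q : ℝ → ℝ} {c : ℝ} (hq : Tendsto q (𝓝[≠] 0) (𝓝 c)) :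
    Tendsto (fun t => (1 - Real.exp (-(2 * (t ^ 2 * q t)))) / t ^ 2) (𝓝[≠] 0) (𝓝 (2 * c)) := by
  have hu : Tendsto (fun t : ℝ => -(2 * (t ^ 2 * q t))) (𝓝[≠] 0) (𝓝 0) := by
    have ht : Tendsto (fun t : ℝ => t ^ 2) (𝓝[≠] 0) (𝓝 0) := by
      simpa using ((continuous_pow 2).tendsto (0 : ℝ)).mono_left nhdsWithin_le_nhds
    simpa using ((ht.mul hq).const_mul 2).neg
  -- `dslope` extends the difference quotient of `exp` by its derivative `1`, so arguments equal to
  -- `0` need no separate case.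
  have hd : Tendsto (dslope Real.exp 0) (𝓝 0) (𝓝 1) := by
    have := (continuousAt_dslope_same.2 (Real.differentiableAt_exp (x := 0))).tendsto
    simpa [dslope_same] using this
  have h := (hq.const_mul 2).mul (hd.comp hu)
  rw [mul_one] at h
  refine h.congr' ?_
  filter_upwards [self_mem_nhdsWithin] with t ht
  have ht : t ≠ 0 := ht
  have := sub_smul_dslope Real.exp 0 (-(2 * (t ^ 2 * q t)))
  simp only [sub_zero, smul_eq_mul, Real.exp_zero] at this
  simp only [Function.comp]
  rw [eq_div_iff (by positivity)]
  linarith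

/-- The second moment of a Lévy measure is the variance of the corresponding infinitely divisible
random variable. -/
lemma memLp_and_variance_of_charFun {β : Type*} [MeasurableSpace β] {ν : Measure β}
    [IsFiniteMeasure ν] [IsProbabilityMeasure m] {Z : β → ℝ} (hX : AEMeasurable X m)
    (hZ : AEMeasurable Z ν) (hZ2 : Integrable (fun b => Z b ^ 2) ν)
    (h : ∀ t : ℝ, ∫ a, Complex.exp (t * X a * Complex.I) ∂m =
      Complex.exp (∫ b, (Complex.exp (t * Z b * Complex.I) - 1) ∂ν)) :
    MemLp X 2 m ∧ variance X m = ∫ b, Z b ^ 2 ∂ν := by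
  have hre : ∀ t : ℝ, (∫ b, (Complex.exp (t * Z b * Complex.I) - 1) ∂ν).re =
      -∫ b, (1 - Real.cos (t * Z b)) ∂ν := fun t => by
    rw [← Complex.reCLM_apply, ← ContinuousLinearMap.integral_comp_comm, ← integral_neg]
    · refine integral_congr_ae (ae_of_all _ fun b => ?_)
      have := Complex.exp_ofReal_mul_I_re (t * Z b)
      push_cast at this
      simp [this]
    · refine Integrable.sub (Integrable.of_bound
        (AEMeasurable.aestronglyMeasurable (by fun_prop)) 1 (ae_of_all _ fun b => ?_))
        (integrable_const _)
      exact le_of_eq (by exact_mod_cast Complex.norm_exp_ofReal_mul_I (t * Z b))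
  have hXs : AEMeasurable (fun p : α × α => X p.1 - X p.2) (m.prod m) :=
    hX.comp_fst.sub hX.comp_snd
  have hlim := tendsto_one_sub_exp_div (tendsto_integral_one_sub_cos_div hZ hZ2)
  -- Here `E cos(t(X - X')) = |φ(t)|² = exp(2 Re ψ(t))`, where `ψ` is the cumulant integral and `-Re
  -- ψ(t) = ∫ (1 - cos(tZ)) dν`.
  have hlim2 : Tendsto (fun t => ∫ p : α × α, (1 - Real.cos (t * (X p.1 - X p.2))) / t ^ 2
      ∂(m.prod m)) (𝓝[≠] 0) (𝓝 (2 * ∫ b, Z b ^ 2 / 2 ∂ν)) := by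
    refine hlim.congr' ?_
    filter_upwards [self_mem_nhdsWithin] with t ht
    have ht : t ≠ 0 := ht
    rw [integral_div, integral_div, mul_div_cancel₀ _ (by positivity),
      integral_sub (μ := m.prod m) (integrable_const _), integral_cos_sub hX, h, Complex.normSq_eq_norm_sq, Complex.norm_exp,
      hre, ← Real.exp_nat_mul]
    · simp
    · exact Integrable.of_bound (AEMeasurable.aestronglyMeasurable (by fun_prop)) 1
        (ae_of_all _ fun p => Real.abs_cos_le_one _)
  have hi := integrable_sq_of_tendsto hXs hlim2
  have hL := memLp_two_of_integrable_sub_sq hX hi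
  refine ⟨hL, ?_⟩
  have := tendsto_nhds_unique (tendsto_integral_one_sub_cos_div hXs hi) hlim2
  rw [integral_div, integral_div, integral_sub_sq hL] at this
  linarith

end TrawlProcess

/-! ### Lévy bases, shifted trawls and the seed -/

namespace TrawlProcess

/-- A Lévy measure on the nonzero integer lattice with `∫ min(1, ‖y‖) ν(dy) < ∞` is finite. -/
lemma IsIntegerLevyMeasure.isFiniteMeasure {n : ℕ} {ν : Measure (EuclideanSpace ℝ (Fin n))}
    (hν : IsIntegerLevyMeasure ν) : IsFiniteMeasure ν := by
  refine ⟨lt_of_le_of_lt (le_of_eq ?_) hν.integrable_min⟩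
  rw [← setLIntegral_one, setLIntegral_univ]
  -- A nonzero integer point has norm at least `1`, so the integrand is `1` almost everywhere and
  -- the integral is the total mass.
  refine lintegral_congr_ae ?_
  filter_upwards [show ∀ᵐ y ∂ν, y ≠ 0 ∧ ∀ k, ∃ m : ℤ, y k = (m : ℝ) from hν.concentrated] with y hy
  obtain ⟨h0, hy⟩ := hy
  obtain ⟨k, hk⟩ : ∃ k, y k ≠ 0 := by
    by_contra! h
    exact h0 (PiLp.ext h)
  obtain ⟨z, hz⟩ := hy k
  have hz0 : z ≠ 0 := fun h => hk (by simp [hz, h])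
  have h1 : (1 : ℝ) ≤ ‖y‖ := by
    refine le_trans ?_ (PiLp.norm_apply_le y k)
    rw [hz, Real.norm_eq_abs]
    exact_mod_cast Int.one_le_abs hz0
  rw [eq_comm, min_eq_left_iff, ← ofReal_norm]
  simpa using ENNReal.ofReal_le_ofReal h1

lemma measurePreserving_sub_snd (t : ℝ) :
    MeasurePreserving (fun p : Strip => ((p.1, p.2 - t) : Strip)) volume volume :=
  (MeasurePreserving.id volume).prod (measurePreserving_sub_right volume t)

lemma measurableSet_shift {A : Set Strip} (hA : MeasurableSet A) (t : ℝ) :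
    MeasurableSet (shift A t) :=
  (measurePreserving_sub_snd t).measurable hA

lemma volume_shift {A : Set Strip} (hA : MeasurableSet A) (t : ℝ) :
    volume (shift A t) = volume A :=
  (measurePreserving_sub_snd t).measure_preimage hA.nullMeasurableSet

lemma volume_real_shift_inter_shift {n : ℕ} {A : Fin n → Set Strip} (hA : ∀ k, IsTrawl (A k))
    (i j : Fin n) (t h : ℝ) :
    volume.real (shift (A i) t ∩ shift (A j) (t + h)) = autocorrelator A i j h := by
  have he : shift (A i) t ∩ shift (A j) (t + h) = shift (A i ∩ shift (A j) h) t := by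
    ext p
    simp [shift, sub_sub]
  rw [he, autocorrelator, measureReal_def, volume_shift
    ((hA i).measurableSet.inter (measurableSet_shift (hA j).measurableSet h)), measureReal_def]

lemma kappa_eq {n : ℕ} (ν : Measure (EuclideanSpace ℝ (Fin n))) (i j : Fin n) :
    kappa ν i j = ∫ y, y i * y j ∂ν := by
  unfold kappa jointLevyMeasure
  rw [integral_map (by fun_prop) (by fun_prop)]

section LevyBasis

variable {Ω : Type*} {n : ℕ} {ν : Measure (EuclideanSpace ℝ (Fin n))}
  {N : Ω → Measure (EuclideanSpace ℝ (Fin n) × Strip)} {B C : Set Strip} {i j : Fin n}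

/-- Moving the restriction to `B` into the integrand gives a function that separates `y` from `(x,
s)`, as needed to factor integrals over `ν ⊗ Leb`. -/
lemma levyBasis_eq (hB : MeasurableSet B) (i : Fin n) :
    levyBasis N i B = fun ω => ∫ e, e.1 i * B.indicator 1 e.2 ∂(N ω) := by
  funext ω
  rw [levyBasis, ← integral_indicator (MeasurableSet.univ.prod hB)]
  refine integral_congr_ae (ae_of_all _ fun e => ?_)
  by_cases h : e.2 ∈ B <;> simp [h]

lemma measurable_coord_mul_indicator (hB : MeasurableSet B) (i : Fin n) :
    Measurable fun e : EuclideanSpace ℝ (Fin n) × Strip =>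
      e.1 i * B.indicator (1 : Strip → ℝ) e.2 := by
  have : Measurable (B.indicator (1 : Strip → ℝ)) := measurable_one.indicator hB
  fun_prop

lemma integrable_coord_mul_indicator [SFinite ν] (hB : MeasurableSet B) (hB' : volume B ≠ ∞)
    (hi : Integrable (fun y => y i) ν) :
    Integrable (fun e : EuclideanSpace ℝ (Fin n) × Strip =>
      e.1 i * B.indicator (1 : Strip → ℝ) e.2) (intensity ν) :=
  hi.mul_prod ((integrable_indicator_iff hB).2 (integrableOn_const hB'))

lemma coord_mul_indicator_mul (e : EuclideanSpace ℝ (Fin n) × Strip) :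
    (e.1 i * B.indicator (1 : Strip → ℝ) e.2) * (e.1 j * C.indicator (1 : Strip → ℝ) e.2) =
      (e.1 i * e.1 j) * (B ∩ C).indicator (1 : Strip → ℝ) e.2 := by
  rw [Set.inter_indicator_one]
  simp only [Pi.mul_apply]
  ring

variable [MeasurableSpace Ω] {P : Measure Ω} (hN : IsPoissonRandomMeasure N (intensity ν) P)
  (hB : MeasurableSet B) (hB' : volume B ≠ ∞) (hC : MeasurableSet C) (hC' : volume C ≠ ∞)
  (hi : Integrable (fun y => y i) ν) (hj : Integrable (fun y => y j) ν)
  (hij : Integrable (fun y => y i * y j) ν)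

include hB hC hB' hij in
lemma integrable_coord_mul_indicator_mul :
    Integrable (fun e : EuclideanSpace ℝ (Fin n) × Strip =>
      (e.1 i * B.indicator (1 : Strip → ℝ) e.2) * (e.1 j * C.indicator (1 : Strip → ℝ) e.2))
      (intensity ν) := by
  simp_rw [coord_mul_indicator_mul]
  exact hij.mul_prod ((integrable_indicator_iff (hB.inter hC)).2
    (integrableOn_const (measure_ne_top_of_subset Set.inter_subset_left hB')))

include hN hB hB' hi in
lemma integrable_levyBasis [SFinite ν] : Integrable (levyBasis N i B) P := by
  rw [levyBasis_eq hB]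
  exact (hN.integrable_integral (measurable_coord_mul_indicator hB i)
    (integrable_coord_mul_indicator hB hB' hi)).1

include hN hB hB' hi hC hC' hj hij in
lemma integrable_levyBasis_mul [SFinite ν] :
    Integrable (fun ω => levyBasis N i B ω * levyBasis N j C ω) P := by
  rw [levyBasis_eq hB, levyBasis_eq hC]
  exact (hN.integrable_integral_mul (measurable_coord_mul_indicator hB i)
    (integrable_coord_mul_indicator hB hB' hi) (measurable_coord_mul_indicator hC j)
    (integrable_coord_mul_indicator hC hC' hj)
    (integrable_coord_mul_indicator_mul hB hB' hC hij)).1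

include hN hB hB' hi hC hC' hj hij in
lemma covariance_levyBasis [SFinite ν] [IsProbabilityMeasure P] :
    covariance (levyBasis N i B) (levyBasis N j C) P = volume.real (B ∩ C) * kappa ν i j := by
  rw [levyBasis_eq hB, levyBasis_eq hC, hN.covariance_integral (measurable_coord_mul_indicator hB i)
    (integrable_coord_mul_indicator hB hB' hi) (measurable_coord_mul_indicator hC j)
    (integrable_coord_mul_indicator hC hC' hj)
    (integrable_coord_mul_indicator_mul hB hB' hC hij)]
  simp_rw [coord_mul_indicator_mul]
  rw [intensity, integral_prod_mul (fun y : EuclideanSpace ℝ (Fin n) => y i * y j),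
    integral_indicator_one (hB.inter hC), kappa_eq, mul_comm]

end LevyBasis

/-- The variance of a component of a Lévy seed is the second moment of the Lévy measure. -/
lemma IsLevySeed.memLp_and_variance {Ω' : Type*} [MeasurableSpace Ω'] {P' : Measure Ω'}
    [IsProbabilityMeasure P'] {n : ℕ} {L' : Ω' → EuclideanSpace ℝ (Fin n)}
    {ν : Measure (EuclideanSpace ℝ (Fin n))} [IsFiniteMeasure ν] (hL' : IsLevySeed L' ν P')
    {i : Fin n} (hi : Integrable (fun y => y i ^ 2) ν) :
    MemLp (fun ω => L' ω i) 2 P' ∧ variance (fun ω => L' ω i) P' = kappa ν i i := by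
  have hm := hL'.aemeasurable
  rw [kappa_eq]
  simp_rw [← sq]
  refine memLp_and_variance_of_charFun (by fun_prop) (by fun_prop) hi fun t => ?_
  -- The direction `θ = t eᵢ` isolates the `i`-th coordinate.
  have h := hL'.charFun_eq (EuclideanSpace.single i t)
  rw [charFun_apply, integral_map hm (by fun_prop)] at h
  simpa [EuclideanSpace.inner_single_left, EuclideanSpace.inner_single_right, mul_comm] using h

end TrawlProcess

theorem mainTheorem3 {Ω Ω' : Type*} [MeasurableSpace Ω] [MeasurableSpace Ω']
    (P : Measure Ω) [IsProbabilityMeasure P] (P' : Measure Ω') [IsProbabilityMeasure P']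
    {n : ℕ} (ν : Measure (EuclideanSpace ℝ (Fin n))) (hν : TrawlProcess.IsIntegerLevyMeasure ν)
    (N : Ω → Measure (EuclideanSpace ℝ (Fin n) × TrawlProcess.Strip))
    (hN : TrawlProcess.IsPoissonRandomMeasure N (TrawlProcess.intensity ν) P)
    (A : Fin n → Set TrawlProcess.Strip) (hA : ∀ k, TrawlProcess.IsTrawl (A k))
    (L' : Ω' → EuclideanSpace ℝ (Fin n)) (hL' : TrawlProcess.IsLevySeed L' ν P')
    (i j : Fin n) (hij : i ≤ j) :
    -- the covariance, whenever the first moments and the mixed moment of `ν` exist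
    (Integrable (fun y => y i) ν → Integrable (fun y => y j) ν →
      Integrable (fun y => y i * y j) ν →
      ∀ t h : ℝ, 0 ≤ t → 0 ≤ h →
        Integrable (TrawlProcess.trawlProcess N A i t) P ∧
        Integrable (TrawlProcess.trawlProcess N A j (t + h)) P ∧
        Integrable (fun ω => TrawlProcess.trawlProcess N A i t ω *
          TrawlProcess.trawlProcess N A j (t + h) ω) P ∧
        covariance (TrawlProcess.trawlProcess N A i t)
            (TrawlProcess.trawlProcess N A j (t + h)) P =
          TrawlProcess.autocorrelator A i j h * TrawlProcess.kappa ν i j) ∧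
    -- the correlation, whenever the second moments of `ν` exist
    (Integrable (fun y => y i ^ 2) ν → Integrable (fun y => y j ^ 2) ν →
      MemLp (fun ω => L' ω i) 2 P' ∧ MemLp (fun ω => L' ω j) 2 P' ∧
      ∀ t h : ℝ, 0 ≤ t → 0 ≤ h →
        MemLp (TrawlProcess.trawlProcess N A i t) 2 P ∧
        MemLp (TrawlProcess.trawlProcess N A j (t + h)) 2 P ∧
        variance (TrawlProcess.trawlProcess N A i t) P =
          volume.real (A i) * variance (fun ω => L' ω i) P' ∧
        variance (TrawlProcess.trawlProcess N A j (t + h)) P =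
          volume.real (A j) * variance (fun ω => L' ω j) P' ∧
        TrawlProcess.correlation (TrawlProcess.trawlProcess N A i t)
            (TrawlProcess.trawlProcess N A j (t + h)) P =
          TrawlProcess.autocorrelator A i j h * TrawlProcess.kappa ν i j /
            Real.sqrt (volume.real (A i) * variance (fun ω => L' ω i) P' *
              (volume.real (A j) * variance (fun ω => L' ω j) P')) ∧
        TrawlProcess.correlation (TrawlProcess.trawlProcess N A i t)
            (TrawlProcess.trawlProcess N A j (t + h)) P =
          TrawlProcess.autocorrelator A i j h /
              Real.sqrt (volume.real (A i) * volume.real (A j)) *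
            (TrawlProcess.kappa ν i j /
              Real.sqrt (variance (fun ω => L' ω i) P' * variance (fun ω => L' ω j) P'))) := by
  have := hν.isFiniteMeasure
  have hm : ∀ k t, MeasurableSet (TrawlProcess.shift (A k) t) := fun k t =>
    TrawlProcess.measurableSet_shift (hA k).measurableSet t
  have hv : ∀ k t, volume (TrawlProcess.shift (A k) t) ≠ ∞ := fun k t => by
    rw [TrawlProcess.volume_shift (hA k).measurableSet]
    exact (hA k).volume_lt_top.ne
  have hint : ∀ k, Integrable (fun y => y k) ν → ∀ t,
      Integrable (TrawlProcess.trawlProcess N A k t) P := fun k hk t =>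
    TrawlProcess.integrable_levyBasis hN (hm k t) (hv k t) hk
  have hcov : Integrable (fun y => y i) ν → Integrable (fun y => y j) ν →
      Integrable (fun y => y i * y j) ν → ∀ t h : ℝ,
      covariance (TrawlProcess.trawlProcess N A i t)
        (TrawlProcess.trawlProcess N A j (t + h)) P =
          TrawlProcess.autocorrelator A i j h * TrawlProcess.kappa ν i j := fun hi hj hij t h => by
    rw [← TrawlProcess.volume_real_shift_inter_shift hA]
    exact TrawlProcess.covariance_levyBasis hN (hm i t) (hv i t) (hm j (t + h)) (hv j (t + h))
      hi hj hij
  refine ⟨fun hi hj hij t h _ _ => ⟨hint i hi t, hint j hj (t + h),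
    TrawlProcess.integrable_levyBasis_mul hN (hm i t) (hv i t) (hm j (t + h)) (hv j (t + h))
      hi hj hij, hcov hi hj hij t h⟩, fun hi2 hj2 => ?_⟩
  have hL2 : ∀ k, Integrable (fun y => y k ^ 2) ν → MemLp (fun y => y k) 2 ν := fun k hk =>
    (memLp_two_iff_integrable_sq (by fun_prop)).2 hk
  have hY : ∀ k, Integrable (fun y => y k ^ 2) ν → ∀ t,
      MemLp (TrawlProcess.trawlProcess N A k t) 2 P ∧
      variance (TrawlProcess.trawlProcess N A k t) P =
        volume.real (A k) * variance (fun ω => L' ω k) P' := fun k hk t => by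
    -- Finiteness of `ν` makes square integrable coordinates integrable. The variance is then the
    -- covariance formula with equal indices and equal sets, and `κ_{k,k}` is the seed variance.
    have h1 := (hL2 k hk).integrable one_le_two
    have h2 : Integrable (fun y => y k * y k) ν := by simpa only [sq] using hk
    have hi := hint k h1 t
    refine ⟨(memLp_two_iff_integrable_sq hi.aestronglyMeasurable).2 ?_, ?_⟩
    · simp_rw [sq]
      exact TrawlProcess.integrable_levyBasis_mul hN (hm k t) (hv k t) (hm k t) (hv k t) h1 h1 h2
    · rw [← covariance_self hi.aemeasurable, (hL'.memLp_and_variance hk).2]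
      refine (TrawlProcess.covariance_levyBasis hN (hm k t) (hv k t) (hm k t) (hv k t)
        h1 h1 h2).trans ?_
      rw [Set.inter_self, measureReal_def, TrawlProcess.volume_shift (hA k).measurableSet,
        measureReal_def]
  refine ⟨(hL'.memLp_and_variance hi2).1, (hL'.memLp_and_variance hj2).1, fun t h _ _ => ?_⟩
  have hcor : TrawlProcess.correlation (TrawlProcess.trawlProcess N A i t)
      (TrawlProcess.trawlProcess N A j (t + h)) P =
      TrawlProcess.autocorrelator A i j h * TrawlProcess.kappa ν i j /
        Real.sqrt (volume.real (A i) * variance (fun ω => L' ω i) P' *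
          (volume.real (A j) * variance (fun ω => L' ω j) P')) := by
    -- Integrability of `yᵢ yⱼ` comes from Hölder's inequality for two square integrable
    -- coordinates.
    rw [TrawlProcess.correlation, (hY i hi2 t).2, (hY j hj2 (t + h)).2,
      hcov ((hL2 i hi2).integrable one_le_two) ((hL2 j hj2).integrable one_le_two)
        ((hL2 i hi2).integrable_mul (hL2 j hj2))]
  refine ⟨(hY i hi2 t).1, (hY j hj2 (t + h)).1, (hY i hi2 t).2, (hY j hj2 (t + h)).2, hcor, ?_⟩
  -- Splitting the root needs only nonnegativity of the product of the two trawl areas, and with `x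
  -- / 0 = 0` the quotient splits even when a denominator vanishes.
  rw [hcor, mul_mul_mul_comm, Real.sqrt_mul (by positivity), mul_div_mul_comm]
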